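/- Let $c_0$ and $c$ be the Banach spaces of complex sequences $x=(x_n)_{n\ge 0}$ that converge to $0$, respectively that converge in $\mathbb{C}$, both with the norm $\|x\|=\sup_{n\ge 0}|x_n|$. For $t\in[0,1)$ let $C_t$ be the generalized Cesàro operator $$C_t x=\left(\frac{t^n x_0+t^{n-1}x_1+\dots+x_n}{n+1}\right)_{n\ge 0},$$ which maps each of $c_0$ and $c$ continuously into itself. Put $\Lambda=\{\frac1{n+1}: n=0,1,2,\dots\}$ and $\Lambda_0=\Lambda\cup\{0\}$. For a bounded linear operator $T$ on a complex Banach space $X$, let $\sigma(T;X)$ denote its spectrum and let $\sigma_{pt}(T;X)$ denote its point spectrum, i.e. the set of $\lambda\in\mathbb{C}$ for which $\lambda I-T$ is not injective. The operator $T$ is called power bounded if $\sup_{n\ge1}\|T^n\|<\infty$, uniformly mean ergodic if the averages $\frac1n\sum_{m=1}^n T^m$ converge in operator norm as $n\to\infty$, and supercyclic if there is $x\in X$ such that $\{\lambda T^n x:\lambda\in\mathbb{C},\ n\ge 0\}$ is dense in $X$. Let $0\le t<1$. Then $$\|C_t\|_{c_0\to c_0}=1=\|C_t\|_{c\to c}.$$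 Moreover, $C_t$ is compact on both $c_0$ and $c$, with $$\sigma_{pt}(C_t;c_0)=\sigma_{pt}(C_t;c)=\Lambda\quad\text{and}\quad \sigma(C_t;c_0)=\sigma(C_t;c)=\Lambda_0.$$ Also, $C_t$ is power bounded and uniformly mean ergodic on both $c_0$ and $c$, but it is not supercyclic on either of them. -/

import Mathlib

open Filter Topology
open scoped ENNReal

noncomputable section

namespace GenCesaro

/-- The space `ℓ^∞` of bounded complex sequences (indices `0, 1, 2, …`) with the supremum norm. -/
abbrev LInfty : Type := lp (fun _ : ℕ => ℂ) ∞

/-- The space `c` of convergent complex sequences with the supremum norm. -/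
def c : Submodule ℂ LInfty where
  carrier := {x | ∃ l : ℂ, Tendsto (fun n => x n) atTop (𝓝 l)}
  add_mem' := by
    rintro x y ⟨l, hl⟩ ⟨m, hm⟩
    exact ⟨l + m, hl.add hm⟩
  zero_mem' := ⟨0, tendsto_const_nhds⟩
  smul_mem' := by
    rintro a x ⟨l, hl⟩
    exact ⟨a * l, hl.const_mul a⟩

/-- The space `c₀` of complex null sequences with the supremum norm. -/
def c0 : Submodule ℂ LInfty where
  carrier := {x | Tendsto (fun n => x n) atTop (𝓝 0)}
  add_mem' := by
    intro x y hx hy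
    simpa using Tendsto.add (Set.mem_ofPred.mp hx) (Set.mem_ofPred.mp hy)
  zero_mem' := tendsto_const_nhds
  smul_mem' := by
    intro a x hx
    simpa using Tendsto.const_mul a (Set.mem_ofPred.mp hx)

theorem c0_le_c : c0 ≤ c := fun _ hx => ⟨0, hx⟩

/-- Every convergent sequence is bounded, so `c` contains every convergent sequence. -/
theorem exists_mem_c {x : ℕ → ℂ} {l : ℂ} (hx : Tendsto x atTop (𝓝 l)) :
    ∃ y ∈ c, (⇑y : ℕ → ℂ) = x := by
  have hb : Memℓp (E := fun _ : ℕ => ℂ) x ∞ := by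
    apply memℓp_infty
    exact hx.norm.bddAbove_range
  exact ⟨⟨x, hb⟩, ⟨l, hx⟩, rfl⟩

/-- The generalized Cesàro operator on the space of all complex sequences:
`(C_t x)_n = (t^n x_0 + t^(n-1) x_1 + ⋯ + x_n) / (n + 1)`. -/
def cesaro (t : ℝ) : (ℕ → ℂ) →ₗ[ℂ] (ℕ → ℂ) where
  toFun x n := (∑ k ∈ Finset.range (n + 1), (t : ℂ) ^ (n - k) * x k) / ((n : ℂ) + 1)
  map_add' x y := by
    funext n
    simp [mul_add, Finset.sum_add_distrib, add_div]
  map_smul' a x := by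
    funext n
    simp only [Pi.smul_apply, smul_eq_mul, RingHom.id_apply]
    rw [← mul_div_assoc, Finset.mul_sum]
    congr 1
    exact Finset.sum_congr rfl fun k _ => by ring

theorem norm_cesaro_le {t : ℝ} (ht : t ∈ Set.Ico (0 : ℝ) 1) (x : LInfty) (n : ℕ) :
    ‖cesaro t x n‖ ≤ (∑ k ∈ Finset.range (n + 1), t ^ k) * ‖x‖ / ((n : ℝ) + 1) := by
  have hn : ‖((n : ℂ) + 1)‖ = (n : ℝ) + 1 := by
    rw [← Nat.cast_succ, Complex.norm_natCast, Nat.cast_succ]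
  simp only [cesaro, LinearMap.coe_mk, AddHom.coe_mk, norm_div, hn]
  gcongr
  calc ‖∑ k ∈ Finset.range (n + 1), (t : ℂ) ^ (n - k) * x k‖
      ≤ ∑ k ∈ Finset.range (n + 1), t ^ (n - k) * ‖x‖ := by
        apply norm_sum_le_of_le
        intro k _
        rw [norm_mul, norm_pow, Complex.norm_real, Real.norm_of_nonneg ht.1]
        exact mul_le_mul_of_nonneg_left (lp.norm_apply_le_norm ENNReal.top_ne_zero x k)
          (pow_nonneg ht.1 _)
    _ = (∑ k ∈ Finset.range (n + 1), t ^ k) * ‖x‖ := by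
        rw [← Finset.sum_mul, ← Finset.sum_range_reflect (fun k => t ^ k) (n + 1)]
        rfl

theorem norm_cesaro_le_norm {t : ℝ} (ht : t ∈ Set.Ico (0 : ℝ) 1) (x : LInfty) (n : ℕ) :
    ‖cesaro t x n‖ ≤ ‖x‖ := by
  refine (norm_cesaro_le ht x n).trans ?_
  rw [div_le_iff₀ (by positivity), mul_comm]
  gcongr
  calc ∑ k ∈ Finset.range (n + 1), t ^ k
      ≤ ∑ _k ∈ Finset.range (n + 1), (1 : ℝ) :=
        Finset.sum_le_sum fun k _ => pow_le_one₀ ht.1 ht.2.le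
    _ = (n : ℝ) + 1 := by simp

theorem tendsto_cesaro {t : ℝ} (ht : t ∈ Set.Ico (0 : ℝ) 1) (x : LInfty) :
    Tendsto (cesaro t x) atTop (𝓝 0) := by
  have hlim : Tendsto (fun n : ℕ => ((1 - t)⁻¹ * ‖x‖) * (1 / ((n : ℝ) + 1))) atTop (𝓝 0) := by
    simpa using (tendsto_one_div_add_atTop_nhds_zero_nat (𝕜 := ℝ)).const_mul ((1 - t)⁻¹ * ‖x‖)
  refine squeeze_zero_norm (fun n => (norm_cesaro_le ht x n).trans ?_) hlim
  rw [mul_one_div]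
  gcongr
  rw [← tsum_geometric_of_lt_one ht.1 ht.2]
  exact (summable_geometric_of_lt_one ht.1 ht.2).sum_le_tsum _ fun k _ => pow_nonneg ht.1 k

theorem memℓp_cesaro {t : ℝ} (ht : t ∈ Set.Ico (0 : ℝ) 1) (x : LInfty) :
    Memℓp (E := fun _ : ℕ => ℂ) (cesaro t x) ∞ := by
  apply memℓp_infty
  refine ⟨‖x‖, ?_⟩
  rintro _ ⟨n, rfl⟩
  exact norm_cesaro_le_norm ht x n

/-- For `0 ≤ t < 1` and a subspace `X` of `ℓ^∞` containing `c₀`, the restriction of the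
generalized Cesàro operator to `X`, as a continuous linear operator from `X` into `X`. -/
def cesaroOn (X : Submodule ℂ LInfty) (hX : c0 ≤ X) (t : ℝ) (ht : t ∈ Set.Ico (0 : ℝ) 1) :
    X →L[ℂ] X :=
  LinearMap.mkContinuous
    { toFun := fun x => ⟨⟨cesaro t (x : LInfty), memℓp_cesaro ht x⟩, hX (tendsto_cesaro ht x)⟩
      map_add' := fun x y => by
        apply Subtype.ext
        apply Subtype.ext
        exact map_add (cesaro t) ((x : LInfty) : ℕ → ℂ) ((y : LInfty) : ℕ → ℂ)
      map_smul' := fun a x => by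
        apply Subtype.ext
        apply Subtype.ext
        exact map_smul (cesaro t) a ((x : LInfty) : ℕ → ℂ) }
    1 (fun x => by
      rw [one_mul]
      exact lp.norm_le_of_forall_le (norm_nonneg _) fun n => norm_cesaro_le_norm ht x n)

theorem cesaroOn_apply (X : Submodule ℂ LInfty) (hX : c0 ≤ X) (t : ℝ)
    (ht : t ∈ Set.Ico (0 : ℝ) 1) (x : X) :
    (⇑(cesaroOn X hX t ht x : LInfty) : ℕ → ℂ) = cesaro t (⇑(x : LInfty)) := rfl

/-- The generalized Cesàro operator `C_t : c₀ → c₀`. -/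
def cesaroC0 (t : ℝ) (ht : t ∈ Set.Ico (0 : ℝ) 1) : c0 →L[ℂ] c0 := cesaroOn c0 le_rfl t ht

/-- The generalized Cesàro operator `C_t : c → c`. -/
def cesaroC (t : ℝ) (ht : t ∈ Set.Ico (0 : ℝ) 1) : c →L[ℂ] c := cesaroOn c c0_le_c t ht

section Operators

variable {X : Type*} [NormedAddCommGroup X] [NormedSpace ℂ X]

/-- The point spectrum: all complex `z` for which `z I - T` is not injective. -/
def pointSpectrum (T : X →L[ℂ] X) : Set ℂ :=
  {z | ¬ Function.Injective (z • ContinuousLinearMap.id ℂ X - T)}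

/-- `T` is power bounded: `sup_{n ≥ 1} ‖T^n‖ < ∞`. -/
def IsPowerBounded (T : X →L[ℂ] X) : Prop :=
  ∃ M : ℝ, ∀ n : ℕ, 1 ≤ n → ‖T ^ n‖ ≤ M

/-- The Cesàro means `T_[n] = (1 / n) (T + T^2 + ⋯ + T^n)` of `T`, for `n ≥ 1`. -/
def cesaroMean (T : X →L[ℂ] X) (n : ℕ) : X →L[ℂ] X :=
  (n : ℂ)⁻¹ • ∑ m ∈ Finset.Icc 1 n, T ^ m

/-- `T` is uniformly mean ergodic: its Cesàro means converge in operator norm. -/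
def IsUniformlyMeanErgodic (T : X →L[ℂ] X) : Prop :=
  ∃ P : X →L[ℂ] X, Tendsto (cesaroMean T) atTop (𝓝 P)

/-- `T` is supercyclic: some projective orbit `{z T^n x : z ∈ ℂ, n ≥ 0}` is dense. -/
def IsSupercyclic (T : X →L[ℂ] X) : Prop :=
  ∃ x : X, Dense {y : X | ∃ (z : ℂ) (n : ℕ), y = z • (T ^ n) x}

end Operators

/-- The set `Λ = {1 / (n + 1) : n ≥ 0}`. -/
def Lam : Set ℂ := {z | ∃ n : ℕ, z = 1 / ((n : ℂ) + 1)}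

/-- The set `Λ₀ = Λ ∪ {0}`. -/
def Lam0 : Set ℂ := Lam ∪ {0}

end GenCesaro

end

open Filter Topology
open scoped ENNReal

noncomputable section

namespace GenCesaro

/-! The matrix of `C_t` is lower triangular with diagonal entries `1 / (n + 1)`, and its `n`-th row
has absolute sum at most `min 1 ((1 - t)⁻¹ / (n + 1))`. The bound `1` makes all powers contractions,
with equality for `C_t` because the coordinate `x_0` is preserved. The decaying bound makes `C_t` a
norm limit of its finite-rank truncations, hence compact.

Triangularity confines the eigenvalues to `Λ`, and each is attained at an explicit null sequence, so
`c₀` and `c` have the same point spectrum. Riesz theory identifies the nonzero spectrum with it, and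
`0` is a limit of eigenvalues.

For mean ergodicity, a rank-one projection `P` onto the fixed points is split off; then `1` is not
in the spectrum of `T - P`, and a telescoping sum shows that the means tend to `P`. Supercyclicity
fails because the transpose has two independent eigenfunctionals, for `1` and `1/2`. The argument
uses only coordinates and the sup norm, so `SeqModel` treats both spaces at once. -/

theorem isClosed_c : IsClosed (c : Set LInfty) := by
  refine isClosed_of_closure_subset fun x hx => ?_
  suffices h : CauchySeq (fun n => x n) from cauchySeq_tendsto_of_complete h
  rw [Metric.cauchySeq_iff']
  intro ε hε
  obtain ⟨y, ⟨l, hl⟩, hxy⟩ := Metric.mem_closure_iff.1 hx (ε / 3) (by positivity)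
  obtain ⟨N, hN⟩ := Metric.cauchySeq_iff'.1 hl.cauchySeq (ε / 3) (by positivity)
  refine ⟨N, fun n hn => ?_⟩
  have hd (k : ℕ) : dist (x k) (y k) < ε / 3 := by
    rw [dist_eq_norm] at hxy ⊢
    exact (lp.norm_apply_le_norm ENNReal.top_ne_zero (x - y) k).trans_lt hxy
  have h₁ := hd n
  have h₂ := hd N
  rw [dist_comm] at h₂
  have h₃ := dist_triangle4 (x n) (y n) (y N) (x N)
  linarith [hN n hn]

theorem isClosed_c0 : IsClosed (c0 : Set LInfty) := by
  refine isClosed_of_closure_subset fun x hx => ?_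
  change Tendsto (fun n => x n) atTop (𝓝 0)
  rw [Metric.tendsto_atTop]
  intro ε hε
  obtain ⟨y, hy, hxy⟩ := Metric.mem_closure_iff.1 hx (ε / 2) (by positivity)
  obtain ⟨N, hN⟩ := Metric.tendsto_atTop.1 hy (ε / 2) (by positivity)
  refine ⟨N, fun n hn => ?_⟩
  have h₁ : dist (x n) (y n) < ε / 2 := by
    rw [dist_eq_norm] at hxy ⊢
    exact (lp.norm_apply_le_norm ENNReal.top_ne_zero (x - y) n).trans_lt hxy
  linarith [hN n hn, dist_triangle (x n) (y n) 0]

/-- Completeness is needed for norm limits of compact operators to be compact and for the Fredholm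
alternative. -/
instance : CompleteSpace c := isClosed_c.completeSpace_coe

instance : CompleteSpace c0 := isClosed_c0.completeSpace_coe

/-! ### Mean ergodicity and supercyclicity of abstract operators -/

section Operators

variable {E : Type*} [NormedAddCommGroup E] [NormedSpace ℂ E]

theorem mem_pointSpectrum_iff {T : E →L[ℂ] E} {z : ℂ} :
    z ∈ pointSpectrum T ↔ ∃ x, x ≠ 0 ∧ T x = z • x := by
  have h : z ∈ pointSpectrum T ↔ ¬ ∀ x, (z • ContinuousLinearMap.id ℂ E - T) x = 0 → x = 0 :=
    not_congr (injective_iff_map_eq_zero _)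
  rw [h]
  push Not
  refine exists_congr fun x => ?_
  simp only [sub_apply, smul_apply,
    ContinuousLinearMap.id_apply, sub_eq_zero]
  exact ⟨fun h => ⟨h.2, h.1.symm⟩, fun h => ⟨h.2.symm, h.1⟩⟩

theorem hasEigenvalue_iff_mem_pointSpectrum {T : E →L[ℂ] E} {z : ℂ} :
    Module.End.HasEigenvalue (T : Module.End ℂ E) z ↔ z ∈ pointSpectrum T := by
  rw [mem_pointSpectrum_iff]
  constructor
  · intro h
    obtain ⟨x, hx⟩ := h.exists_hasEigenvector
    exact ⟨x, hx.2, hx.apply_eq_smul⟩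
  · rintro ⟨x, hx, hTx⟩
    exact Module.End.hasEigenvalue_of_hasEigenvector
      ⟨Module.End.mem_eigenspace_iff.2 hTx, hx⟩

theorem isCompactOperator_smulRight (f : E →L[ℂ] ℂ) (v : E) :
    IsCompactOperator (f.smulRight v) :=
  ((isCompactOperator_id (E := ℂ)).comp_clm f).clm_comp (ContinuousLinearMap.toSpanSingleton ℂ v)

theorem sum_Icc_pow_mul_one_sub {R : Type*} [Ring R] (a : R) (n : ℕ) :
    (∑ m ∈ Finset.Icc 1 n, a ^ m) * (1 - a) = a - a ^ (n + 1) := by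
  induction n with
  | zero => simp
  | succ n ih =>
    rw [Finset.sum_Icc_succ_top (by omega), add_mul, ih, mul_sub, mul_one, ← pow_succ]
    abel

/-- A power bounded compact operator commuting with a projection `P` onto its fixed points is
uniformly mean ergodic. -/
theorem tendsto_cesaroMean_of_isCompactOperator [CompleteSpace E] {T P : E →L[ℂ] E}
    (hT : IsCompactOperator T) (hP : IsCompactOperator P) {M : ℝ} (hM : ∀ n, ‖T ^ n‖ ≤ M)
    (hTP : T * P = P) (hPT : P * T = P) (hPP : P * P = P)
    (hfix : ∀ x, T x = x → P x = 0 → x = 0) :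
    Tendsto (cesaroMean T) atTop (𝓝 P) := by
  set Q := T - P with hQ
  have hTnP (n : ℕ) : T ^ n * P = P := by
    induction n with
    | zero => simp
    | succ n ih => rw [pow_succ, mul_assoc, hTP, ih]
  have hQpow (n : ℕ) : Q ^ (n + 1) = T ^ (n + 1) - P := by
    induction n with
    | zero => simp [hQ]
    | succ n ih =>
      rw [pow_succ, ih, hQ, sub_mul, mul_sub, mul_sub, hTnP, hPT, hPP, ← pow_succ]
      abel
  -- Fredholm alternative for the compact `Q`: since `P * Q = 0`, a fixed vector of `Q` is killed by
  -- `P`, so it is fixed by `T` and vanishes by `hfix`.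
  have hunit : IsUnit (1 - Q) := by
    have hQc : IsCompactOperator Q := hT.sub hP
    rcases hQc.hasEigenvalue_or_mem_resolventSet (one_ne_zero (α := ℂ)) with h | h
    · obtain ⟨x, hx, hQx⟩ := mem_pointSpectrum_iff.1 (hasEigenvalue_iff_mem_pointSpectrum.1 h)
      rw [one_smul] at hQx
      have hPx : P x = 0 := by
        rw [← hQx]
        change (P * (T - P)) x = 0
        rw [mul_sub, hPT, hPP, sub_self]
        rfl
      refine absurd (hfix x ?_ hPx) hx
      have : T x - P x = x := hQx
      rwa [hPx, sub_zero] at this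
    · simpa [spectrum.mem_resolventSet_iff] using h
  obtain ⟨R, hR⟩ := hunit.exists_right_inv
  have hmean (n : ℕ) (hn : 1 ≤ n) :
      cesaroMean T n = P + (n : ℂ)⁻¹ • ((T - T ^ (n + 1)) * R) := by
    have hsum : ∑ m ∈ Finset.Icc 1 n, T ^ m = n • P + ∑ m ∈ Finset.Icc 1 n, Q ^ m := by
      have : ∑ m ∈ Finset.Icc 1 n, T ^ m = ∑ m ∈ Finset.Icc 1 n, (P + Q ^ m) := by
        refine Finset.sum_congr rfl fun m hm => ?_
        obtain ⟨k, rfl⟩ : ∃ k, m = k + 1 := ⟨m - 1, by have := (Finset.mem_Icc.1 hm).1; omega⟩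
        rw [hQpow]
        abel
      rw [this, Finset.sum_add_distrib]
      simp
    have hQsum : ∑ m ∈ Finset.Icc 1 n, Q ^ m = (T - T ^ (n + 1)) * R := by
      have := congrArg (· * R) (sum_Icc_pow_mul_one_sub Q n)
      simp only [mul_assoc, hR, mul_one] at this
      rw [this, hQpow, hQ]
      congr 1
      abel
    have hn' : (n : ℂ) ≠ 0 := by exact_mod_cast (by omega : n ≠ 0)
    rw [cesaroMean, hsum, hQsum, smul_add, ← Nat.cast_smul_eq_nsmul ℂ, inv_smul_smul₀ hn']
  have hlim : Tendsto (fun n : ℕ => (n : ℂ)⁻¹ • ((T - T ^ (n + 1)) * R)) atTop (𝓝 0) := by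
    have h0 : Tendsto (fun n : ℕ => (n : ℝ)⁻¹ * ((M + M) * ‖R‖)) atTop (𝓝 0) := by
      simpa using (tendsto_inv_atTop_nhds_zero_nat (𝕜 := ℝ)).mul_const ((M + M) * ‖R‖)
    refine squeeze_zero_norm (fun n => ?_) h0
    rw [norm_smul, norm_inv, Complex.norm_natCast]
    gcongr
    refine (norm_mul_le _ _).trans ?_
    gcongr
    refine (norm_sub_le _ _).trans (add_le_add ?_ (hM _))
    simpa using hM 1
  have := hlim.const_add P
  rw [add_zero] at this
  -- The formula fails at `n = 0` in general: there the mean is `0` by the convention `0⁻¹ = 0`.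
  exact this.congr' ((eventually_ge_atTop 1).mono fun n hn => (hmean n hn).symm)

/-- An operator whose transpose has two eigenvectors, for the eigenvalue `1` and for an eigenvalue
of modulus at most `1`, that are separated by a vector is not supercyclic. -/
theorem not_isSupercyclic_of_eigenfunctionals {T : E →L[ℂ] E} {f g : E →L[ℂ] ℂ} {μ : ℂ}
    (hμ : ‖μ‖ ≤ 1) (hf : ∀ x, f (T x) = f x) (hg : ∀ x, g (T x) = μ * g x)
    (hf0 : f ≠ 0) {v : E} (hfv : f v = 0) (hgv : g v ≠ 0) : ¬ IsSupercyclic T := by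
  rintro ⟨x, hx⟩
  have hfn (n : ℕ) : f ((T ^ n) x) = f x := by
    induction n with
    | zero => simp
    | succ n ih => rw [pow_succ', mul_apply_eq_comp, hf, ih]
  have hgn (n : ℕ) : g ((T ^ n) x) = μ ^ n * g x := by
    induction n with
    | zero => simp
    | succ n ih => rw [pow_succ', mul_apply_eq_comp, hg, ih, pow_succ', mul_assoc]
  by_cases hfx : f x = 0
  · have hcl : IsClosed {y : E | f y = 0} := isClosed_eq f.continuous continuous_const
    have hsub : {y : E | ∃ (z : ℂ) (n : ℕ), y = z • (T ^ n) x} ⊆ {y : E | f y = 0} := by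
      rintro _ ⟨z, n, rfl⟩
      rw [Set.mem_ofPred_eq, map_smul, hfn, hfx, smul_zero]
    refine hf0 (ContinuousLinearMap.ext fun y => ?_)
    exact closure_minimal hsub hcl (hx y)
  -- Along the projective orbit the ratio of `‖g‖` to `‖f‖` never exceeds its value at `x`, because
  -- `‖μ‖ ≤ 1`. This closed condition would pass to the whole space, but `v` violates it.
  · have hcl : IsClosed {y : E | ‖f x‖ * ‖g y‖ ≤ ‖g x‖ * ‖f y‖} :=
      isClosed_le (by fun_prop) (by fun_prop)
    have hsub : {y : E | ∃ (z : ℂ) (n : ℕ), y = z • (T ^ n) x} ⊆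
        {y : E | ‖f x‖ * ‖g y‖ ≤ ‖g x‖ * ‖f y‖} := by
      rintro _ ⟨z, n, rfl⟩
      simp only [Set.mem_ofPred_eq, map_smul, hfn, hgn, smul_eq_mul, norm_mul, norm_pow]
      calc ‖f x‖ * (‖z‖ * (‖μ‖ ^ n * ‖g x‖)) = ‖μ‖ ^ n * (‖g x‖ * (‖z‖ * ‖f x‖)) := by ring
        _ ≤ 1 * (‖g x‖ * (‖z‖ * ‖f x‖)) := by
          gcongr
          exact pow_le_one₀ (norm_nonneg _) hμ
        _ = _ := one_mul _
    have hv : ‖f x‖ * ‖g v‖ ≤ ‖g x‖ * ‖f v‖ := closure_minimal hsub hcl (hx v)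
    rw [hfv, norm_zero, mul_zero] at hv
    exact absurd hv (not_le.2 (mul_pos (norm_pos_iff.2 hfx) (norm_pos_iff.2 hgv)))

end Operators

/-! ### Eigenvectors of the Cesàro matrix -/

theorem cesaro_apply (t : ℝ) (x : ℕ → ℂ) (n : ℕ) :
    cesaro t x n = (∑ k ∈ Finset.range (n + 1), (t : ℂ) ^ (n - k) * x k) / ((n : ℂ) + 1) := rfl

theorem natCast_add_one_ne_zero (n : ℕ) : (n : ℂ) + 1 ≠ 0 := Nat.cast_add_one_ne_zero n

theorem cesaro_zero (t : ℝ) (x : ℕ → ℂ) : cesaro t x 0 = x 0 := by simp [cesaro_apply]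

theorem cesaro_one (t : ℝ) (x : ℕ → ℂ) : cesaro t x 1 = (t * x 0 + x 1) / 2 := by
  simp [cesaro_apply, Finset.sum_range_succ]
  norm_num

/-- The recursion `(n + 2) (C_t x)_(n+1) = t (n + 1) (C_t x)_n + x_(n+1)`. -/
theorem cesaro_succ (t : ℝ) (x : ℕ → ℂ) (n : ℕ) :
    ((n : ℂ) + 2) * cesaro t x (n + 1) = t * (((n : ℂ) + 1) * cesaro t x n) + x (n + 1) := by
  have h2 : ((n + 1 : ℕ) : ℂ) + 1 = (n : ℂ) + 2 := by push_cast; ring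
  have h2' := h2 ▸ natCast_add_one_ne_zero (n + 1)
  rw [cesaro_apply, cesaro_apply, h2, mul_div_cancel₀ _ h2',
    mul_div_cancel₀ _ (natCast_add_one_ne_zero n), Finset.sum_range_succ, Nat.sub_self, pow_zero,
    one_mul, Finset.mul_sum]
  congr 1
  refine Finset.sum_congr rfl fun k hk => ?_
  rw [Nat.succ_sub (Nat.lt_succ_iff.1 (Finset.mem_range.1 hk)), pow_succ']
  ring

/-- The recursion turns the eigenvalue equation into `((n + 2) z - 1) x_(n+1) = t (n + 1) z x_n`,
and the left factor is nonzero off `Λ`. -/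
theorem eq_zero_of_cesaro_eq_smul {t : ℝ} {z : ℂ} (hz : z ∉ Lam) {x : ℕ → ℂ}
    (hx : cesaro t x = z • x) : x = 0 := by
  have hz' (n : ℕ) : ((n : ℂ) + 1) * z - 1 ≠ 0 := fun h =>
    hz ⟨n, (eq_div_iff (natCast_add_one_ne_zero n)).2 (by linear_combination h)⟩
  have hxn (n : ℕ) : cesaro t x n = z * x n := congrFun hx n
  funext n
  induction n with
  | zero =>
    have h := hxn 0
    rw [cesaro_zero] at h
    refine (mul_eq_zero.1 ?_).resolve_left (hz' 0)
    push_cast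
    linear_combination -h
  | succ n ih =>
    have h := cesaro_succ t x n
    rw [hxn, hxn, ih, Pi.zero_apply] at h
    refine (mul_eq_zero.1 ?_).resolve_left (hz' (n + 1))
    push_cast
    linear_combination h

/-- For the eigenvalue `1` the factor degenerates only at index `0`, so `x_0` determines a fixed
sequence. -/
theorem apply_eq_zero_of_cesaro_eq_self {t : ℝ} {x : ℕ → ℂ} (hx : cesaro t x = x)
    (h0 : x 0 = 0) : x = 0 := by
  funext n
  induction n with
  | zero => exact h0
  | succ n ih =>
    have h := cesaro_succ t x n
    rw [hx, ih, Pi.zero_apply] at h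
    refine (mul_eq_zero.1 ?_).resolve_left (natCast_add_one_ne_zero n)
    linear_combination h

/-- The eigenvector of `C_t` for the eigenvalue `1 / (m + 1)`. -/
def eigenseq (t : ℝ) (m n : ℕ) : ℂ := n.choose m * (t : ℂ) ^ (n - m)

theorem eigenseq_self (t : ℝ) (m : ℕ) : eigenseq t m m = 1 := by simp [eigenseq]

/-- The powers of `t` combine to the constant `t^(n-m)`; what remains is the hockey-stick sum of
`k.choose m` and the absorption identity for binomials. -/
theorem cesaro_eigenseq (t : ℝ) (m : ℕ) :
    cesaro t (eigenseq t m) = (1 / ((m : ℂ) + 1)) • eigenseq t m := by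
  funext n
  have hterm : ∀ k ∈ Finset.range (n + 1),
      (t : ℂ) ^ (n - k) * eigenseq t m k = k.choose m * (t : ℂ) ^ (n - m) := by
    intro k hk
    have hk := Finset.mem_range.1 hk
    rcases lt_or_ge k m with h | h
    · simp [eigenseq, Nat.choose_eq_zero_of_lt h]
    · rw [eigenseq, mul_left_comm, ← pow_add]
      congr 2
      omega
  have hsum : ∑ k ∈ Finset.range (n + 1), k.choose m = (n + 1).choose (m + 1) := by
    rw [← Nat.sum_Icc_choose]
    refine (Finset.sum_subset (fun k hk => ?_) fun k hk hk' => ?_).symm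
    · exact Finset.mem_range.2 (Nat.lt_succ_of_le (Finset.mem_Icc.1 hk).2)
    · refine Nat.choose_eq_zero_of_lt ?_
      have := Finset.mem_range.1 hk
      rw [Finset.mem_Icc] at hk'
      omega
  have hsucc : ((n : ℂ) + 1) * n.choose m = (n + 1).choose (m + 1) * ((m : ℂ) + 1) := by
    exact_mod_cast Nat.add_one_mul_choose_eq n m
  rw [cesaro_apply, Finset.sum_congr rfl hterm, ← Finset.sum_mul, ← Nat.cast_sum, hsum,
    Pi.smul_apply, smul_eq_mul, eigenseq, div_mul_eq_mul_div, one_mul,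
    div_eq_div_iff (natCast_add_one_ne_zero n) (natCast_add_one_ne_zero m)]
  linear_combination -(t : ℂ) ^ (n - m) * hsucc

theorem tendsto_eigenseq {t : ℝ} (ht : t ∈ Set.Ico (0 : ℝ) 1) (m : ℕ) :
    Tendsto (eigenseq t m) atTop (𝓝 0) := by
  have hr : ‖(t : ℂ)‖ < 1 := by rw [Complex.norm_real, Real.norm_of_nonneg ht.1]; exact ht.2
  -- Shifting by `m` removes the truncated subtraction and leaves the terms of a convergent series.
  rw [← tendsto_add_atTop_iff_nat m]
  simpa [eigenseq] using (summable_choose_mul_geometric_of_norm_lt_one m hr).tendsto_atTop_zero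

theorem tendsto_single (m : ℕ) : Tendsto (Pi.single m (1 : ℂ) : ℕ → ℂ) atTop (𝓝 0) :=
  tendsto_const_nhds.congr' ((eventually_gt_atTop m).mono fun _ hn =>
    (Pi.single_eq_of_ne (M := fun _ => ℂ) hn.ne' 1).symm)

/-! ### Cesàro operators on sequence spaces -/

/-- A realization of a normed space as a space of bounded sequences containing all null
sequences, with the supremum norm. -/
structure SeqModel (E : Type*) [NormedAddCommGroup E] [NormedSpace ℂ E] where
  /-- The coordinate functionals. -/
  coord : ℕ → E →L[ℂ] ℂ
  norm_coord_le : ∀ n x, ‖coord n x‖ ≤ ‖x‖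
  norm_le : ∀ x C, 0 ≤ C → (∀ n, ‖coord n x‖ ≤ C) → ‖x‖ ≤ C
  /-- The element with prescribed coordinates tending to `0`. -/
  ofNull : ∀ x : ℕ → ℂ, Tendsto x atTop (𝓝 0) → E
  coord_ofNull : ∀ x hx n, coord n (ofNull x hx) = x n

namespace SeqModel

variable {E : Type*} [NormedAddCommGroup E] [NormedSpace ℂ E] (S : SeqModel E)

theorem ext_coord {x y : E} (h : ∀ n, S.coord n x = S.coord n y) : x = y := by
  rw [← sub_eq_zero, ← norm_le_zero_iff]
  exact S.norm_le _ _ le_rfl fun n => by rw [map_sub, h, sub_self, norm_zero]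

/-- The unit sequence supported at `m`. -/
def unitSeq (m : ℕ) : E := S.ofNull (Pi.single m 1) (tendsto_single m)

theorem coord_unitSeq (m n : ℕ) :
    S.coord n (S.unitSeq m) = (Pi.single m (1 : ℂ) : ℕ → ℂ) n := S.coord_ofNull _ _ _

/-- `T` acts on sequences as the generalized Cesàro operator `C_t`. -/
def IsCesaro (t : ℝ) (T : E →L[ℂ] E) : Prop :=
  ∀ n x, S.coord n (T x) = cesaro t (fun k => S.coord k x) n

/-- The bounded sequence of coordinates. -/
def toLInfty (x : E) : LInfty :=
  ⟨fun n => S.coord n x, memℓp_infty ⟨‖x‖, by rintro _ ⟨n, rfl⟩; exact S.norm_coord_le n x⟩⟩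

theorem norm_toLInfty_le (x : E) : ‖S.toLInfty x‖ ≤ ‖x‖ :=
  lp.norm_le_of_forall_le (norm_nonneg _) fun n => S.norm_coord_le n x

variable {S} {t : ℝ} {T : E →L[ℂ] E}

namespace IsCesaro

theorem norm_apply_le (hT : S.IsCesaro t T) (ht : t ∈ Set.Ico (0 : ℝ) 1) (x : E) :
    ‖T x‖ ≤ ‖x‖ := by
  refine S.norm_le _ _ (norm_nonneg _) fun n => ?_
  rw [hT]
  exact (norm_cesaro_le_norm ht (S.toLInfty x) n).trans (S.norm_toLInfty_le x)

theorem norm_eq_one (hT : S.IsCesaro t T) (ht : t ∈ Set.Ico (0 : ℝ) 1) : ‖T‖ = 1 := by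
  refine le_antisymm (T.opNorm_le_bound zero_le_one fun x => ?_) ?_
  · rw [one_mul]
    exact hT.norm_apply_le ht x
  have he : ‖S.unitSeq 0‖ ≤ 1 := by
    refine S.norm_le _ _ zero_le_one fun n => ?_
    rw [coord_unitSeq]
    rcases eq_or_ne n 0 with rfl | h
    · simp
    · simp [h]
  -- Coordinate `0` of `T x` is `x_0`, so `e_0` attains the norm.
  have h1 : (1 : ℝ) ≤ ‖T (S.unitSeq 0)‖ := by
    have h := S.norm_coord_le 0 (T (S.unitSeq 0))
    rwa [hT, cesaro_zero, coord_unitSeq, Pi.single_eq_same, norm_one] at h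
  exact h1.trans (T.unit_le_opNorm _ he)

theorem norm_pow_le (hT : S.IsCesaro t T) (ht : t ∈ Set.Ico (0 : ℝ) 1) (n : ℕ) :
    ‖T ^ n‖ ≤ 1 := by
  refine ContinuousLinearMap.opNorm_le_bound _ zero_le_one fun x => ?_
  induction n with
  | zero => simp
  | succ n ih =>
    rw [pow_succ', mul_apply_eq_comp]
    exact (hT.norm_apply_le ht _).trans ih

theorem isCompactOperator [CompleteSpace E] (hT : S.IsCesaro t T)
    (ht : t ∈ Set.Ico (0 : ℝ) 1) : IsCompactOperator T := by
  -- `F N` keeps the first `N` output coordinates of `T`; the discarded rows have index at least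
  -- `N`, so their sums are at most `(1 - t)⁻¹ / (N + 1)`.
  let F (N : ℕ) : E →L[ℂ] E :=
    ∑ m ∈ Finset.range N, ((S.coord m).comp T).smulRight (S.unitSeq m)
  have hF (N : ℕ) : IsCompactOperator (F N) :=
    (compactOperator (RingHom.id ℂ) E E).sum_mem fun m _ => isCompactOperator_smulRight _ _
  have hFcoord (N n : ℕ) (x : E) :
      S.coord n (F N x) = if n < N then S.coord n (T x) else 0 := by
    simp [F, coord_unitSeq, Pi.single_apply]
  have hbound (N : ℕ) : ‖T - F N‖ ≤ (1 - t)⁻¹ * (1 / ((N : ℝ) + 1)) := by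
    have h1t : 0 < 1 - t := sub_pos.2 ht.2
    refine ContinuousLinearMap.opNorm_le_bound _ (by positivity) fun x => ?_
    refine S.norm_le _ _ (by positivity) fun n => ?_
    rw [sub_apply, map_sub, hFcoord]
    split_ifs with h
    · rw [sub_self, norm_zero]
      positivity
    · rw [sub_zero, hT]
      refine (norm_cesaro_le ht (S.toLInfty x) n).trans ?_
      have hg : ∑ k ∈ Finset.range (n + 1), t ^ k ≤ (1 - t)⁻¹ := by
        rw [← tsum_geometric_of_lt_one ht.1 ht.2]
        exact (summable_geometric_of_lt_one ht.1 ht.2).sum_le_tsum _ fun k _ => pow_nonneg ht.1 k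
      have hN : (N : ℝ) ≤ n := by exact_mod_cast not_lt.1 h
      have hx := S.norm_toLInfty_le x
      calc _ ≤ (1 - t)⁻¹ * ‖x‖ / ((N : ℝ) + 1) := by gcongr
        _ = (1 - t)⁻¹ * (1 / ((N : ℝ) + 1)) * ‖x‖ := by ring
  have hlim : Tendsto F atTop (𝓝 T) := by
    refine tendsto_iff_norm_sub_tendsto_zero.2 ?_
    refine squeeze_zero (fun _ => norm_nonneg _) (fun N => ?_)
      (by simpa using (tendsto_one_div_add_atTop_nhds_zero_nat (𝕜 := ℝ)).const_mul (1 - t)⁻¹)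
    rw [norm_sub_rev]
    simpa using hbound N
  exact isCompactOperator_of_tendsto hlim (Eventually.of_forall hF)

variable (S) in
/-- The eigenvector of `C_t` for the eigenvalue `1 / (m + 1)`. -/
def eigenvec (ht : t ∈ Set.Ico (0 : ℝ) 1) (m : ℕ) : E := S.ofNull (eigenseq t m) (tendsto_eigenseq ht m)

theorem apply_eigenvec (hT : S.IsCesaro t T) (ht : t ∈ Set.Ico (0 : ℝ) 1) (m : ℕ) :
    T (eigenvec S ht m) = (1 / ((m : ℂ) + 1)) • eigenvec S ht m :=
  S.ext_coord fun n => by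
    have h : (fun k => S.coord k (eigenvec S ht m)) = eigenseq t m :=
      funext (S.coord_ofNull _ (tendsto_eigenseq ht m))
    rw [hT, h, cesaro_eigenseq, map_smul, Pi.smul_apply, ← h]

theorem pointSpectrum_eq (hT : S.IsCesaro t T) (ht : t ∈ Set.Ico (0 : ℝ) 1) : pointSpectrum T = Lam := by
  ext z
  rw [mem_pointSpectrum_iff]
  constructor
  · rintro ⟨x, hx0, hx⟩
    by_contra hz
    refine hx0 (S.ext_coord fun n => ?_)
    rw [map_zero]
    refine congrFun (eq_zero_of_cesaro_eq_smul (t := t) hz (x := fun k => S.coord k x) ?_) n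
    funext n
    rw [← hT, hx, map_smul]
    rfl
  · rintro ⟨m, rfl⟩
    refine ⟨eigenvec S ht m, fun h => ?_, hT.apply_eigenvec ht m⟩
    have := congrArg (S.coord m) h
    rw [eigenvec, coord_ofNull, eigenseq_self, map_zero] at this
    exact one_ne_zero this

theorem spectrum_eq [CompleteSpace E] (hT : S.IsCesaro t T) (ht : t ∈ Set.Ico (0 : ℝ) 1) :
    spectrum ℂ T = Lam0 := by
  have hne {z : ℂ} (hz : z ≠ 0) : z ∈ spectrum ℂ T ↔ z ∈ Lam := by
    rw [← (hT.isCompactOperator ht).hasEigenvalue_iff_mem_spectrum hz,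
      hasEigenvalue_iff_mem_pointSpectrum, hT.pointSpectrum_eq ht]
  -- The spectrum is closed and contains the eigenvalues `1 / (n + 1)`.
  have h0 : (0 : ℂ) ∈ spectrum ℂ T := by
    refine (spectrum.isClosed _).mem_of_tendsto
      (tendsto_one_div_add_atTop_nhds_zero_nat (𝕜 := ℂ)) (Eventually.of_forall fun n => ?_)
    exact (hne (one_div_ne_zero (natCast_add_one_ne_zero n))).2 ⟨n, rfl⟩
  ext z
  rcases eq_or_ne z 0 with rfl | hz
  · exact iff_of_true h0 (Or.inr rfl)
  · rw [hne hz, Lam0, Set.mem_union, Set.mem_singleton_iff, or_iff_left hz]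

theorem isPowerBounded (hT : S.IsCesaro t T) (ht : t ∈ Set.Ico (0 : ℝ) 1) :
    IsPowerBounded T :=
  ⟨1, fun n _ => hT.norm_pow_le ht n⟩

theorem isUniformlyMeanErgodic [CompleteSpace E]
    (hT : S.IsCesaro t T) (ht : t ∈ Set.Ico (0 : ℝ) 1) :
    IsUniformlyMeanErgodic T := by
  have hv : S.coord 0 (eigenvec S ht 0) = 1 :=
    (S.coord_ofNull _ _ _).trans (eigenseq_self t 0)
  -- The limit is `x ↦ x_0 v`, where `v = (t^n)` spans the fixed points.
  refine ⟨(S.coord 0).smulRight (eigenvec S ht 0),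
    tendsto_cesaroMean_of_isCompactOperator (hT.isCompactOperator ht)
      (isCompactOperator_smulRight _ _) (hT.norm_pow_le ht) ?_ ?_ ?_ ?_⟩
  · ext1 x
    simp only [mul_apply_eq_comp, ContinuousLinearMap.smulRight_apply, map_smul,
      hT.apply_eigenvec ht]
    simp
  · ext1 x
    simp only [mul_apply_eq_comp, ContinuousLinearMap.smulRight_apply, hT _ _, cesaro_zero]
  · ext1 x
    simp only [mul_apply_eq_comp, ContinuousLinearMap.smulRight_apply, map_smul, hv, one_smul]
  · intro x hx hPx
    have h0 : S.coord 0 x = 0 := by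
      simpa [hv] using congrArg (S.coord 0) hPx
    refine S.ext_coord fun n => ?_
    rw [map_zero]
    refine congrFun (apply_eq_zero_of_cesaro_eq_self (t := t) (x := fun k => S.coord k x) ?_ h0) n
    funext n
    rw [← hT, hx]

theorem not_isSupercyclic (hT : S.IsCesaro t T) : ¬ IsSupercyclic T := by
  -- `g x = x_1 - t x_0` is the left eigenvector for `1/2`, since `(t x_0 + x_1) / 2 - t x_0 = (x_1
  -- - t x_0) / 2`; `e_1` separates it from `f`.
  refine not_isSupercyclic_of_eigenfunctionals (f := S.coord 0)
    (g := S.coord 1 - (t : ℂ) • S.coord 0) (μ := 1 / 2) (v := S.unitSeq 1)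
    (by norm_num) (fun x => ?_) (fun x => ?_) (fun h => ?_) ?_ ?_
  · rw [hT _ _, cesaro_zero]
  · simp only [sub_apply, smul_apply, hT _ _, cesaro_zero, cesaro_one, smul_eq_mul]
    ring
  · have := congrArg (fun f : E →L[ℂ] ℂ => f (S.unitSeq 0)) h
    simp [coord_unitSeq] at this
  · simp [coord_unitSeq]
  · simp [coord_unitSeq]

end IsCesaro

end SeqModel

/-! ### The concrete spaces and the conclusion -/

/-- A space of bounded sequences containing `c₀`, with its own coordinates. -/
def seqModel (X : Submodule ℂ LInfty) (hX : c0 ≤ X) : SeqModel X where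
  coord n := (lp.evalCLM ℂ (fun _ : ℕ => ℂ) ∞ n).comp X.subtypeL
  norm_coord_le n x := lp.norm_apply_le_norm ENNReal.top_ne_zero (x : LInfty) n
  norm_le _ _ hC h := lp.norm_le_of_forall_le hC h
  ofNull x hx := ⟨⟨x, memℓp_infty hx.norm.bddAbove_range⟩, hX hx⟩
  coord_ofNull _ _ _ := rfl

theorem isCesaro_cesaroOn (X : Submodule ℂ LInfty) (hX : c0 ≤ X) (t : ℝ)
    (ht : t ∈ Set.Ico (0 : ℝ) 1) : (seqModel X hX).IsCesaro t (cesaroOn X hX t ht) :=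
  fun _ _ => rfl

end GenCesaro

end

theorem propositionP5p2 (t : ℝ) (ht : t ∈ Set.Ico (0 : ℝ) 1) :
    (‖GenCesaro.cesaroC0 t ht‖ = 1 ∧ ‖GenCesaro.cesaroC t ht‖ = 1) ∧
    (IsCompactOperator (GenCesaro.cesaroC0 t ht) ∧ IsCompactOperator (GenCesaro.cesaroC t ht)) ∧
    (GenCesaro.pointSpectrum (GenCesaro.cesaroC0 t ht) = GenCesaro.Lam ∧
      GenCesaro.pointSpectrum (GenCesaro.cesaroC t ht) = GenCesaro.Lam) ∧
    (spectrum ℂ (GenCesaro.cesaroC0 t ht) = GenCesaro.Lam0 ∧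
      spectrum ℂ (GenCesaro.cesaroC t ht) = GenCesaro.Lam0) ∧
    (GenCesaro.IsPowerBounded (GenCesaro.cesaroC0 t ht) ∧
      GenCesaro.IsPowerBounded (GenCesaro.cesaroC t ht)) ∧
    (GenCesaro.IsUniformlyMeanErgodic (GenCesaro.cesaroC0 t ht) ∧
      GenCesaro.IsUniformlyMeanErgodic (GenCesaro.cesaroC t ht)) ∧
    (¬ GenCesaro.IsSupercyclic (GenCesaro.cesaroC0 t ht) ∧
      ¬ GenCesaro.IsSupercyclic (GenCesaro.cesaroC t ht)) := by
  have h₀ : (GenCesaro.seqModel GenCesaro.c0 le_rfl).IsCesaro t (GenCesaro.cesaroC0 t ht) :=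
    GenCesaro.isCesaro_cesaroOn _ _ t ht
  have h₁ : (GenCesaro.seqModel GenCesaro.c GenCesaro.c0_le_c).IsCesaro t
      (GenCesaro.cesaroC t ht) :=
    GenCesaro.isCesaro_cesaroOn _ _ t ht
  exact ⟨⟨h₀.norm_eq_one ht, h₁.norm_eq_one ht⟩,
    ⟨h₀.isCompactOperator ht, h₁.isCompactOperator ht⟩,
    ⟨h₀.pointSpectrum_eq ht, h₁.pointSpectrum_eq ht⟩,
    ⟨h₀.spectrum_eq ht, h₁.spectrum_eq ht⟩,
    ⟨h₀.isPowerBounded ht, h₁.isPowerBounded ht⟩,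
    ⟨h₀.isUniformlyMeanErgodic ht, h₁.isUniformlyMeanErgodic ht⟩,
    ⟨h₀.not_isSupercyclic, h₁.not_isSupercyclic⟩⟩
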